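/- Let $\mathbb{F}_{q^2}$ be a finite field of order $q^2$ and characteristic $p$, and let $n=\overline{n}\,p^{\nu}$ be a positive integer with $p\nmid\overline{n}$ and $\nu\ge 0$. Let $\lambda\in\mathbb{F}_{q^2}$ be a nonzero element whose multiplicative order $r$ satisfies $r\mid (q+1)$, and let $\Lambda$ be the (unique) element of $\mathbb{F}_{q^2}$ with $\Lambda^{p^\nu}=\lambda$. A linear code $C\subseteq\mathbb{F}_{q^2}^n$ (an $\mathbb{F}_{q^2}$-subspace) is $\lambda$-constacyclic if $(\lambda c_{n-1},c_0,\dots,c_{n-2})\in C$ whenever $(c_0,\dots,c_{n-1})\in C$. Its Hermitian dual is $C^{\perp_H}=\{u\in\mathbb{F}_{q^2}^n : \sum_{i=0}^{n-1}u_iv_i^q=0 \text{ for all } v\in C\}$ and its Hermitian hull is $\mathrm{Hull}_H(C)=C\cap C^{\perp_H}$. Let $\mathcal{C}(n,\lambda,q^2)$ be the set of all $\lambda$-constacyclic codes of length $n$ over $\mathbb{F}_{q^2}$ and let $$E_H(n,\lambda,q^2)=\sum_{C\in\mathcal{C}(n,\lambda,q^2)}\frac{\dim \mathrm{Hull}_H(C)}{|\mathcal{C}(n,\lambda,q^2)|}$$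 be the average dimension of their Hermitian hulls. For $f(x)=\sum_{i=0}^k a_ix^i\in\mathbb{F}_{q^2}[x]$ of degree $k$ with $a_0\ne 0$ put $f^\dagger(x)=a_0^{-q}\sum_{i=0}^k a_i^q x^{k-i}$, and call $f$ self-conjugate-reciprocal if $f=f^\dagger$. Let $B$ be the sum of the degrees of the monic irreducible self-conjugate-reciprocal factors of $x^{\overline{n}}-\Lambda$ over $\mathbb{F}_{q^2}$. Then $$E_H(n,\lambda,q^2)=n\left(\frac13-\frac1{6(p^\nu+1)}\right)-B\left(\frac{p^\nu+1}{12}+\frac{2-3\delta}{12(p^\nu+1)}\right),$$ where $\delta=1$ if $p^\nu$ is even and $\delta=0$ otherwise. -/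

import Mathlib

namespace ConstacyclicHull

open Polynomial

variable {F : Type*} [Field F] {n : ℕ}

/-- The constacyclic shift `(c₀, c₁, …, cₙ₋₁) ↦ (lam * cₙ₋₁, c₀, …, cₙ₋₂)`. -/
def constaShift (lam : F) (c : Fin n → F) : Fin n → F := fun i =>
  if (i : ℕ) = 0 then lam * c ⟨n - 1, by have := i.isLt; omega⟩ else c ⟨(i : ℕ) - 1, by have := i.isLt; omega⟩

/-- A linear code of length `n` is `lam`-constacyclic if it is closed under the constacyclic
shift. -/
def IsConstacyclic (lam : F) (C : Submodule F (Fin n → F)) : Prop :=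
  ∀ c ∈ C, constaShift lam c ∈ C

/-- The Hermitian dual `{u | ∑ uᵢ vᵢ ^ q = 0 for all v ∈ C}` of a linear code `C` over a field
with `q ^ 2` elements. -/
def hermitianDual (q : ℕ) (C : Submodule F (Fin n → F)) : Submodule F (Fin n → F) where
  carrier := {u | ∀ v ∈ C, ∑ i, u i * v i ^ q = 0}
  zero_mem' := by
    intro v _
    simp
  add_mem' := by
    intro a b ha hb v hv
    simp [add_mul, Finset.sum_add_distrib, ha v hv, hb v hv]
  smul_mem' := by
    intro r a ha v hv
    simp [mul_assoc, ← Finset.mul_sum, ha v hv]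

/-- The Hermitian hull `C ∩ C^⊥H`. -/
def hermitianHull (q : ℕ) (C : Submodule F (Fin n → F)) : Submodule F (Fin n → F) :=
  C ⊓ hermitianDual q C

/-- The finite set of all `lam`-constacyclic codes of length `n` over the finite field `F`. -/
noncomputable def constacyclicCodes [Finite F] (n : ℕ) (lam : F) :
    Finset (Submodule F (Fin n → F)) :=
  (Set.toFinite {C : Submodule F (Fin n → F) | IsConstacyclic lam C}).toFinset

/-- The average dimension `E_H(n, lam, q²)` of the Hermitian hull of `lam`-constacyclic codes of
length `n` over the finite field `F` with `q ^ 2` elements. -/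
noncomputable def averageHullDim [Finite F] (q n : ℕ) (lam : F) : ℚ :=
  ∑ C ∈ constacyclicCodes n lam,
    (Module.finrank F (hermitianHull q C) : ℚ) / ((constacyclicCodes n lam).card : ℚ)

/-- The conjugate-reciprocal polynomial `a₀^(-q) * ∑ aᵢ ^ q x ^ (k - i)` of a polynomial
`f = a₀ + a₁ x + ⋯ + aₖ x ^ k` of degree `k` with `a₀ ≠ 0`. -/
noncomputable def conjReciprocal (q : ℕ) (f : F[X]) : F[X] :=
  C ((f.coeff 0 ^ q)⁻¹) *
    ∑ i ∈ Finset.range (f.natDegree + 1), C (f.coeff i ^ q) * X ^ (f.natDegree - i)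

/-- A polynomial with nonzero constant term is self-conjugate-reciprocal if it equals its
conjugate-reciprocal polynomial. -/
def IsSelfConjReciprocal (q : ℕ) (f : F[X]) : Prop :=
  f.coeff 0 ≠ 0 ∧ conjReciprocal q f = f

open Classical in
/-- The sum of the degrees of the self-conjugate-reciprocal polynomials among the monic
irreducible factors of `x ^ m - Lam`. -/
noncomputable def selfConjDegree (q m : ℕ) (Lam : F) : ℕ :=
  (((UniqueFactorizationMonoid.normalizedFactors (X ^ m - C Lam : F[X])).filter
    (IsSelfConjReciprocal q)).map natDegree).sum

end ConstacyclicHull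

namespace ConstacyclicHull

open Polynomial

/-! ### Averages over exponent vectors -/

section Counting

/-! With `P = p ^ ν`, the modulus `X ^ n - lam` equals `(X ^ nbar - Lam) ^ P`, and the base is
separable. If the `f i` are its monic irreducible factors, constacyclic codes correspond to exponent
vectors `k` with `0 ≤ k i ≤ P`. Since `lam ^ (q + 1) = 1`, conjugate reciprocation permutes the
factors by an involution `τ`.

The shift is unitary for the Hermitian form, so the adjoint of multiplication by `g` is, up to a
power of the shift, multiplication by the conjugate reverse of `g` (`sesqForm_aeval`). Hence the
dual has exponents `P - k (τ i)`, the hull has `max (k i) (P - k (τ i))` (`hermitianHull_code`), and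
its dimension is the sum of `deg (f i) * min (P - k i) (k (τ i))`.

Averaging is then linear in `i`. If `τ i = i`, one uniform exponent is involved and the mean is `(P
^ 2 - [P odd]) / (4 (P + 1))`; otherwise two independent ones are, with mean `P (2 P + 1) / (6 (P +
1))`. The fixed factors have total degree `B`. -/

theorem card_mul_sum_apply {ι A R : Type*} [Fintype ι] [DecidableEq ι] [Fintype A]
    [CommSemiring R] (i : ι) (G : A → R) :
    (Fintype.card A : R) * ∑ k : ι → A, G (k i) =
      (Fintype.card A : R) ^ Fintype.card ι * ∑ a, G a := by
  have h : ∑ k : ι → A, G (k i) = ∑ x : A × ({j // j ≠ i} → A), G x.1 :=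
    Fintype.sum_equiv (Equiv.funSplitAt i A) _ _ fun k => by simp
  have hc : Fintype.card ι = Fintype.card {j // j ≠ i} + 1 := by
    have : 0 < Fintype.card ι := Fintype.card_pos_iff.mpr ⟨i⟩
    rw [Fintype.card_subtype_compl, Fintype.card_subtype_eq]
    omega
  rw [h, Fintype.sum_prod_type, hc]
  simp only [Finset.sum_const, Finset.card_univ, nsmul_eq_mul, ← Finset.mul_sum,
    Fintype.card_fun, Nat.cast_pow]
  ring

theorem card_sq_mul_sum_apply_apply {ι A R : Type*} [Fintype ι] [DecidableEq ι] [Fintype A]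
    [CommSemiring R] {i j : ι} (hij : j ≠ i) (G : A → A → R) :
    (Fintype.card A : R) ^ 2 * ∑ k : ι → A, G (k i) (k j) =
      (Fintype.card A : R) ^ Fintype.card ι * ∑ a, ∑ b, G a b := by
  have h : ∑ k : ι → A, G (k i) (k j) =
      ∑ x : A × ({j // j ≠ i} → A), G x.1 (x.2 ⟨j, hij⟩) :=
    Fintype.sum_equiv (Equiv.funSplitAt i A) _ _ fun k => by simp
  have hc : Fintype.card ι = Fintype.card {j // j ≠ i} + 1 := by
    have : 0 < Fintype.card ι := Fintype.card_pos_iff.mpr ⟨i⟩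
    rw [Fintype.card_subtype_compl, Fintype.card_subtype_eq]
    omega
  rw [h, Fintype.sum_prod_type, hc, sq, mul_assoc, Finset.mul_sum]
  simp only [card_mul_sum_apply (⟨j, hij⟩ : {j // j ≠ i})]
  rw [← Finset.mul_sum]
  ring

theorem four_mul_sum_min_sub_self (P : ℕ) :
    4 * ∑ a ∈ Finset.range (P + 1), min (P - a) a + (if Even P then 0 else 1) = P ^ 2 := by
  induction P using Nat.twoStepInduction with
  | zero => simp
  | one => simp [Finset.sum_range_succ]
  | more P ih _ =>
    -- The two end terms vanish, and each of the `P + 1` inner terms exceeds its counterpart for `P`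
    -- by one.
    have h : ∑ a ∈ Finset.range (P + 2 + 1), min (P + 2 - a) a =
        ∑ a ∈ Finset.range (P + 1), min (P - a) a + (P + 1) := by
      rw [Finset.sum_range_succ, Finset.sum_range_succ']
      have : ∀ a ∈ Finset.range (P + 1), min (P + 2 - (a + 1)) (a + 1) = min (P - a) a + 1 := by
        intro a ha
        rw [Finset.mem_range] at ha
        omega
      rw [Finset.sum_congr rfl this, Finset.sum_add_distrib]
      simp
    have he : Even (P + 2) ↔ Even P := by simp [Nat.even_add]
    rw [h, if_congr he rfl rfl]
    linarith

theorem six_mul_sum_sum_min (P : ℕ) :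
    6 * ∑ a ∈ Finset.range (P + 1), ∑ b ∈ Finset.range (P + 1), min a b =
      P * (P + 1) * (2 * P + 1) := by
  induction P with
  | zero => simp
  | succ P ih =>
    have h1 : ∀ a ∈ Finset.range (P + 1), min a (P + 1) = a := by
      intro a ha; rw [Finset.mem_range] at ha; omega
    have h2 : ∀ a ∈ Finset.range (P + 1), min (P + 1) a = a := by
      intro a ha; rw [Finset.mem_range] at ha; omega
    have hg := Finset.sum_range_id_mul_two (P + 1)
    rw [Finset.sum_range_succ]
    simp only [Finset.sum_range_succ _ (P + 1)]
    rw [Finset.sum_add_distrib, Finset.sum_congr rfl h1, Finset.sum_congr rfl h2]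
    simp only [Nat.add_sub_cancel] at hg
    simp only [min_self]
    nlinarith

theorem six_mul_sum_sum_min_sub (P : ℕ) :
    6 * ∑ a ∈ Finset.range (P + 1), ∑ b ∈ Finset.range (P + 1), min (P - a) b =
      P * (P + 1) * (2 * P + 1) := by
  rw [← six_mul_sum_sum_min, ← Finset.sum_range_reflect]
  congr 1
  refine Finset.sum_congr rfl fun a ha => Finset.sum_congr rfl fun b _ => ?_
  rw [Finset.mem_range] at ha
  congr 1
  omega

end Counting

/-! ### Conjugate reversal of polynomials -/

section ConjReverse

variable {F : Type*} [Field F]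

/-- The reverse of a polynomial, with `σ` applied to all coefficients. -/
noncomputable def conjReverse (σ : F →+* F) (f : F[X]) : F[X] := (f.map σ).reverse

variable (σ : F →+* F)

theorem conjReverse_mul (f g : F[X]) :
    conjReverse σ (f * g) = conjReverse σ f * conjReverse σ g := by
  rw [conjReverse, Polynomial.map_mul, reverse_mul_of_domain, conjReverse, conjReverse]

/-- `conjReverse` as a monoid homomorphism. -/
noncomputable def conjReverseHom : F[X] →* F[X] where
  toFun := conjReverse σ
  map_one' := by simpa [conjReverse] using reverse_C (1 : F)
  map_mul' := conjReverse_mul σ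

@[simp] theorem conjReverseHom_apply (f : F[X]) : conjReverseHom σ f = conjReverse σ f := rfl

theorem conjReverse_X_pow_sub_C (n : ℕ) {a : F} (ha : a * σ a = 1) :
    Associated (conjReverse σ (X ^ n - C a)) (X ^ n - C a) := by
  have hσ0 : σ a ≠ 0 := right_ne_zero_of_mul_eq_one ha
  have h : conjReverse σ (X ^ n - C a) = C (-σ a) * (X ^ n - C a) := by
    have hd : (X ^ n - C (σ a)).natDegree = n := natDegree_X_pow_sub_C
    rw [conjReverse, Polynomial.map_sub, Polynomial.map_pow, map_X, map_C, reverse, hd,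
      reflect_sub, reflect_monomial, reflect_C, revAt_le le_rfl, mul_sub, ← C_mul, neg_mul,
      mul_comm (σ a), ha]
    simp
    ring
  rw [h]
  exact associated_unit_mul_left _ _ (isUnit_C.mpr (neg_ne_zero.mpr hσ0).isUnit)

theorem conjReverse_coeff_zero (f : F[X]) :
    (conjReverse σ f).coeff 0 = σ f.leadingCoeff := by
  rw [conjReverse, coeff_zero_reverse, leadingCoeff_map]

theorem conjReverse_coeff_zero_ne_zero {f : F[X]} (hf : f ≠ 0) :
    (conjReverse σ f).coeff 0 ≠ 0 := by
  rw [conjReverse_coeff_zero]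
  simpa using hf

theorem natDegree_conjReverse {f : F[X]} (hf : f.coeff 0 ≠ 0) :
    (conjReverse σ f).natDegree = f.natDegree := by
  rw [conjReverse, reverse_natDegree, natDegree_map,
    natTrailingDegree_eq_zero.mpr (Or.inr (by simpa using hf)), Nat.sub_zero]

theorem leadingCoeff_conjReverse {f : F[X]} (hf : f.coeff 0 ≠ 0) :
    (conjReverse σ f).leadingCoeff = σ (f.coeff 0) := by
  rw [conjReverse, reverse_leadingCoeff, trailingCoeff,
    natTrailingDegree_eq_zero.mpr (Or.inr (by simpa using hf)), coeff_map]

variable {σ}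

/-- The nonzero constant term keeps the degree from dropping, so both reversals reflect about the
same degree. -/
theorem conjReverse_conjReverse (hσ : ∀ x, σ (σ x) = x) {f : F[X]} (hf : f.coeff 0 ≠ 0) :
    conjReverse σ (conjReverse σ f) = f := by
  have h := natDegree_conjReverse σ hf
  rw [conjReverse, reverse, natDegree_map, h, conjReverse, reverse, reflect_map, reflect_map,
    reflect_map, natDegree_map, reflect_reflect, Polynomial.map_map]
  have : σ.comp σ = RingHom.id F := RingHom.ext hσ
  rw [this, Polynomial.map_id]

theorem isUnit_of_isUnit_conjReverse {f : F[X]} (hf : f.coeff 0 ≠ 0)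
    (h : IsUnit (conjReverse σ f)) : IsUnit f := by
  have h0 := natDegree_eq_zero_of_isUnit h
  rw [natDegree_conjReverse σ hf] at h0
  rw [eq_C_of_natDegree_eq_zero h0]
  exact isUnit_C.mpr hf.isUnit

theorem irreducible_conjReverse (hσ : ∀ x, σ (σ x) = x) {f : F[X]} (hf : f.coeff 0 ≠ 0)
    (h : Irreducible f) : Irreducible (conjReverse σ f) := by
  refine ⟨fun hu => h.not_isUnit (isUnit_of_isUnit_conjReverse hf hu), fun a b hab => ?_⟩
  have h0 := conjReverse_coeff_zero_ne_zero σ h.ne_zero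
  rw [hab, mul_coeff_zero] at h0
  have hf' := conjReverse_conjReverse hσ hf
  rw [hab, conjReverse_mul] at hf'
  exact (h.isUnit_or_isUnit hf'.symm).imp
    (isUnit_of_isUnit_conjReverse (left_ne_zero_of_mul h0))
    (isUnit_of_isUnit_conjReverse (right_ne_zero_of_mul h0))

variable (σ) in
theorem conjReverse_eq_sum (f : F[X]) :
    conjReverse σ f = ∑ i ∈ Finset.range (f.natDegree + 1),
      C (σ (f.coeff i)) * X ^ (f.natDegree - i) := by
  rw [conjReverse, reverse, natDegree_map, reflect_map]
  have hs : ∀ N (s : Finset ℕ) (g : ℕ → F[X]),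
      (∑ i ∈ s, g i).reflect N = ∑ i ∈ s, (g i).reflect N := fun N s g =>
    map_sum (AddMonoidHom.mk' (reflect N) fun a b => reflect_add a b _) g s
  conv_lhs =>
    enter [2]
    arg 2
    rw [f.as_sum_range_C_mul_X_pow]
  rw [hs, Polynomial.map_sum]
  refine Finset.sum_congr rfl fun i hi => ?_
  rw [reflect_C_mul_X_pow, revAt_le (Nat.lt_succ_iff.mp (Finset.mem_range.mp hi))]
  simp

theorem conjReciprocal_eq {q : ℕ} (hq : ∀ x, σ x = x ^ q) (f : F[X]) :
    conjReciprocal q f = C (σ (f.coeff 0))⁻¹ * conjReverse σ f := by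
  simp only [conjReciprocal, conjReverse_eq_sum, hq]

end ConjReverse

/-! ### Constacyclic codes as ideals modulo `X ^ n - lam` -/

section Shift

variable {F : Type*} [Field F] {n : ℕ}

/-- The constacyclic shift as a linear endomorphism. -/
def shiftEnd (n : ℕ) (lam : F) : Module.End F (Fin n → F) where
  toFun := constaShift lam
  map_add' u v := by
    ext i
    simp only [constaShift, Pi.add_apply]
    split_ifs <;> ring
  map_smul' a v := by
    ext i
    simp only [constaShift, Pi.smul_apply, smul_eq_mul, RingHom.id_apply]
    split_ifs <;> ring

@[simp] theorem shiftEnd_apply (lam : F) (c : Fin n → F) :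
    shiftEnd n lam c = constaShift lam c := rfl

/-- The codeword of a polynomial: the coefficients of its remainder modulo `X ^ n - lam`. -/
noncomputable def word (n : ℕ) (lam : F) : F[X] →ₗ[F] (Fin n → F) where
  toFun g i := (g %ₘ (X ^ n - C lam)).coeff i
  map_add' f g := by ext i; simp [add_modByMonic]
  map_smul' a g := by ext i; simp [smul_modByMonic]

theorem word_apply (lam : F) (g : F[X]) (i : Fin n) :
    word n lam g i = (g %ₘ (X ^ n - C lam)).coeff i := rfl

theorem monic_modulus (hn : 0 < n) (lam : F) : (X ^ n - C lam).Monic :=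
  monic_X_pow_sub_C lam hn.ne'

theorem degree_mod_lt (hn : 0 < n) (lam : F) (g : F[X]) :
    (g %ₘ (X ^ n - C lam)).degree < n := by
  rw [← degree_X_pow_sub_C hn lam]
  exact degree_modByMonic_lt _ (monic_modulus hn lam)

theorem mod_eq_self (hn : 0 < n) (lam : F) {g : F[X]} (h : g.degree < n) :
    g %ₘ (X ^ n - C lam) = g := by
  rw [modByMonic_eq_self_iff (monic_modulus hn lam), degree_X_pow_sub_C hn lam]
  exact h

theorem word_eq_zero_iff (hn : 0 < n) (lam : F) (g : F[X]) :
    word n lam g = 0 ↔ (X ^ n - C lam) ∣ g := by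
  rw [← modByMonic_eq_zero_iff_dvd (monic_modulus hn lam)]
  constructor
  · intro h
    ext i
    rcases lt_or_ge i n with hi | hi
    · exact congrFun h ⟨i, hi⟩
    · exact coeff_eq_zero_of_degree_lt ((degree_mod_lt hn lam g).trans_le (by exact_mod_cast hi))
  · intro h
    ext i
    rw [word_apply, h]
    rfl

theorem word_surjective (hn : 0 < n) (lam : F) : Function.Surjective (word n lam) := by
  classical
  intro c
  refine ⟨ofFn n c, ?_⟩
  ext i
  rw [word_apply, mod_eq_self hn lam (ofFn_degree_lt c)]
  simp

theorem word_eq_word_iff (hn : 0 < n) (lam : F) (f g : F[X]) :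
    word n lam f = word n lam g ↔ (X ^ n - C lam) ∣ f - g := by
  rw [← word_eq_zero_iff hn, map_sub, sub_eq_zero]

theorem word_X_mul (lam : F) (g : F[X]) :
    word n lam (X * g) = shiftEnd n lam (word n lam g) := by
  rcases n.eq_zero_or_pos with rfl | hn
  · exact Subsingleton.elim _ _
  set r := g %ₘ (X ^ n - C lam) with hr
  have hrd : r.degree < n := degree_mod_lt hn lam g
  -- One subtraction reduces `X * r`: the top coefficient leaves degree `n` and returns as `lam`
  -- times itself in degree 0.
  have h1 : word n lam (X * g) = word n lam (X * r - C (r.coeff (n - 1)) * (X ^ n - C lam)) := by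
    rw [word_eq_word_iff hn]
    have := modByMonic_add_div g (X ^ n - C lam)
    rw [← hr] at this
    refine ⟨X * (g /ₘ (X ^ n - C lam)) + C (r.coeff (n - 1)), ?_⟩
    linear_combination X * (-this)
  have hcoeff : ∀ i, (X * r - C (r.coeff (n - 1)) * (X ^ n - C lam)).coeff i =
      (X * r).coeff i - r.coeff (n - 1) * ((if i = n then 1 else 0) - if i = 0 then lam else 0) := by
    intro i
    rw [coeff_sub, coeff_C_mul, coeff_sub, coeff_X_pow, coeff_C]
  have h2 : (X * r - C (r.coeff (n - 1)) * (X ^ n - C lam)).degree < (n : WithBot ℕ) := by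
    rw [degree_lt_iff_coeff_zero]
    intro i hi
    rw [hcoeff]
    obtain ⟨j, rfl⟩ : ∃ j, i = j + 1 := ⟨i - 1, by omega⟩
    rw [coeff_X_mul]
    rcases hi.eq_or_lt with h | h
    · subst h; simp
    · rw [if_neg (by omega), if_neg (by omega), coeff_eq_zero_of_degree_lt
        (hrd.trans_le (by exact_mod_cast (by omega : n ≤ j)))]
      simp
  rw [h1]
  ext i
  rw [word_apply, mod_eq_self hn lam h2, hcoeff, shiftEnd_apply, constaShift]
  have hi := i.isLt
  rw [if_neg hi.ne]
  split_ifs with h0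
  · rw [h0, word_apply, ← hr]
    simp
    ring
  · obtain ⟨j, hj⟩ : ∃ j, (i : ℕ) = j + 1 := ⟨i - 1, by omega⟩
    rw [word_apply, ← hr]
    change _ = r.coeff ((i : ℕ) - 1)
    rw [hj, coeff_X_mul]
    simp

theorem word_mul (lam : F) (f g : F[X]) :
    word n lam (f * g) = aeval (shiftEnd n lam) f (word n lam g) := by
  induction f using Polynomial.induction_on' generalizing g with
  | add a b ha hb => rw [add_mul, map_add, ha, hb, map_add, LinearMap.add_apply]
  | monomial k a =>
    rw [← C_mul_X_pow_eq_monomial]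
    induction k generalizing g with
    | zero => simp [← smul_eq_C_mul]
    | succ k ih =>
      rw [pow_succ, ← mul_assoc, mul_assoc, ih, word_X_mul]
      simp

/-- The constacyclic code generated by a polynomial. -/
noncomputable def code (n : ℕ) (lam : F) (g : F[X]) : Submodule F (Fin n → F) :=
  ((Ideal.span {g}).restrictScalars F).map (word n lam)

theorem word_mem_code_iff (hn : 0 < n) (lam : F) {g : F[X]} (hg : g ∣ X ^ n - C lam) (a : F[X]) :
    word n lam a ∈ code n lam g ↔ g ∣ a := by
  simp only [code, Submodule.mem_map, Submodule.restrictScalars_mem, Ideal.mem_span_singleton]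
  constructor
  · rintro ⟨b, hb, hab⟩
    rw [word_eq_word_iff hn] at hab
    exact (dvd_sub_right hb).mp (hg.trans hab)
  · exact fun h => ⟨a, h, rfl⟩

theorem isConstacyclic_code (lam : F) (g : F[X]) : IsConstacyclic lam (code n lam g) := by
  rintro c ⟨a, ha, rfl⟩
  rw [← shiftEnd_apply, ← word_X_mul]
  exact ⟨X * a, Ideal.mul_mem_left _ _ ha, rfl⟩

theorem code_le_code_iff (hn : 0 < n) (lam : F) {f g : F[X]} (hf : f ∣ X ^ n - C lam)
    (hg : g ∣ X ^ n - C lam) : code n lam f ≤ code n lam g ↔ g ∣ f := by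
  constructor
  · intro h
    exact (word_mem_code_iff hn lam hg f).mp (h ((word_mem_code_iff hn lam hf f).mpr dvd_rfl))
  · intro h c hc
    obtain ⟨a, rfl⟩ := word_surjective hn lam c
    rw [word_mem_code_iff hn lam hg]
    exact h.trans ((word_mem_code_iff hn lam hf a).mp hc)

/-- Shift stability makes the preimage of `D` in `F[X]` an ideal. Its generator divides the modulus
because the modulus maps to the zero word. -/
theorem IsConstacyclic.exists_eq_code (hn : 0 < n) {lam : F} {D : Submodule F (Fin n → F)}
    (hD : IsConstacyclic lam D) : ∃ g, g ∣ X ^ n - C lam ∧ D = code n lam g := by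
  let I : Ideal F[X] :=
    { carrier := {a | word n lam a ∈ D}
      zero_mem' := by simp
      add_mem' := fun {a b} ha hb => by
        simpa using D.add_mem ha hb
      smul_mem' := fun f a ha => by
        change word n lam (f * a) ∈ D
        rw [word_mul]
        have hle : D ≤ D.comap (shiftEnd n lam) := fun c hc => hD c hc
        induction f using Polynomial.induction_on' with
        | add f g hf hg =>
          rw [map_add, LinearMap.add_apply]
          exact D.add_mem hf hg
        | monomial k b =>
          rw [aeval_monomial]
          have hk : ∀ k : ℕ, ((shiftEnd n lam) ^ k) (word n lam a) ∈ D := fun k => by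
            induction k with
            | zero => simpa using ha
            | succ k ih => rw [pow_succ']; exact hD _ ih
          simpa using D.smul_mem b (hk k) }
  obtain ⟨g, hg⟩ := (IsPrincipalIdealRing.principal I).principal
  have hmem : ∀ a, word n lam a ∈ D ↔ g ∣ a := fun a => by
    rw [← Ideal.mem_span_singleton]
    change a ∈ I ↔ _
    rw [hg]
  have hdvd : g ∣ X ^ n - C lam := by
    rw [← hmem, (word_eq_zero_iff hn lam _).mpr dvd_rfl]
    exact D.zero_mem
  refine ⟨g, hdvd, ?_⟩
  ext c
  obtain ⟨a, rfl⟩ := word_surjective hn lam c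
  rw [hmem, word_mem_code_iff hn lam hdvd]

/-- The quotient of the ambient space by the code is `F[X] ⧸ (g)`. -/
theorem finrank_code_add_natDegree (hn : 0 < n) (lam : F) {g : F[X]} (hg : g ∣ X ^ n - C lam) :
    Module.finrank F (code n lam g) + g.natDegree = n := by
  have hg0 : g ≠ 0 := fun h => (monic_modulus hn lam).ne_zero (zero_dvd_iff.mp (h ▸ hg))
  let ψ : F[X] →ₗ[F] ((Fin n → F) ⧸ code n lam g) := (code n lam g).mkQ ∘ₗ word n lam
  have hker : LinearMap.ker ψ = (Ideal.span {g}).restrictScalars F := by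
    ext a
    simp [ψ, Submodule.Quotient.mk_eq_zero, word_mem_code_iff hn lam hg,
      Ideal.mem_span_singleton]
  have hsurj : Function.Surjective ψ :=
    (Submodule.mkQ_surjective _).comp (word_surjective hn lam)
  have e := (LinearMap.quotKerEquivOfSurjective ψ hsurj).finrank_eq
  have h1 : Module.finrank F (F[X] ⧸ LinearMap.ker ψ) = g.natDegree := by
    rw [hker, ← finrank_quotient_span_eq_natDegree (f := g)]
    exact (Submodule.Quotient.restrictScalarsEquiv F (Ideal.span {g})).finrank_eq
  have h2 := Submodule.finrank_quotient_add_finrank (code n lam g)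
  rw [Module.finrank_fin_fun] at h2
  omega

end Shift

/-! ### The Hermitian form and duals -/

section Hermitian

variable {F : Type*} [Field F] {n : ℕ}

/-- The sesquilinear form `∑ uᵢ * σ vᵢ`. -/
def sesqForm (n : ℕ) (σ : F →+* F) : (Fin n → F) →ₗ[F] (Fin n → F) →ₛₗ[σ] F :=
  LinearMap.mk₂'ₛₗ (RingHom.id F) σ (fun u v => ∑ i, u i * σ (v i))
    (fun u u' v => by simp [add_mul, Finset.sum_add_distrib])
    (fun a u v => by simp [Finset.mul_sum, mul_assoc])
    (fun u v v' => by simp [mul_add, Finset.sum_add_distrib])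
    (fun a u v => by simp [Finset.mul_sum, mul_left_comm])

variable {σ : F →+* F}

theorem sesqForm_apply (u v : Fin n → F) : sesqForm n σ u v = ∑ i, u i * σ (v i) := rfl

theorem eq_zero_of_sesqForm_eq_zero {u : Fin n → F} (h : ∀ v, sesqForm n σ u v = 0) : u = 0 := by
  ext i
  have := h (Pi.single i 1)
  rw [sesqForm_apply, Finset.sum_eq_single i] at this
  · simpa using this
  · intro j _ hj
    simp [Pi.single_eq_of_ne hj]
  · simp

theorem sesqForm_shift {lam : F} (hlam : lam * σ lam = 1) (u v : Fin n → F) :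
    sesqForm n σ (shiftEnd n lam u) (shiftEnd n lam v) = sesqForm n σ u v := by
  cases n with
  | zero => simp [sesqForm_apply]
  | succ m =>
    rw [sesqForm_apply, sesqForm_apply, Fin.sum_univ_succ, Fin.sum_univ_castSucc, add_comm]
    congr 1
    have hl : (⟨m + 1 - 1, by omega⟩ : Fin (m + 1)) = Fin.last m := rfl
    simp only [shiftEnd_apply, constaShift, Fin.val_zero, if_true, map_mul, hl]
    linear_combination (u (Fin.last m) * σ (v (Fin.last m))) * hlam

theorem sesqForm_shift_pow {lam : F} (hlam : lam * σ lam = 1) (k : ℕ) (u v : Fin n → F) :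
    sesqForm n σ ((shiftEnd n lam ^ k) u) ((shiftEnd n lam ^ k) v) = sesqForm n σ u v := by
  induction k with
  | zero => simp
  | succ k ih =>
    rw [pow_succ', Module.End.mul_apply, Module.End.mul_apply, sesqForm_shift hlam, ih]

theorem shift_pow_surjective {lam : F} (hlam : lam * σ lam = 1) (k : ℕ) :
    Function.Surjective (shiftEnd n lam ^ k) := by
  rw [← LinearMap.injective_iff_surjective, ← LinearMap.ker_eq_bot, LinearMap.ker_eq_bot']
  intro u hu
  refine eq_zero_of_sesqForm_eq_zero (σ := σ) fun v => ?_
  rw [← sesqForm_shift_pow hlam k, hu]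
  simp

/-- For a unitary `T`, the adjoint of `T ^ i` is its inverse; the factor `T ^ g.natDegree` clears
these negative powers and reverses the coefficients. -/
theorem sesqForm_aeval {lam : F} (hlam : lam * σ lam = 1) (g : F[X]) (u v : Fin n → F) :
    sesqForm n σ ((shiftEnd n lam ^ g.natDegree) u) (aeval (shiftEnd n lam) g v) =
      sesqForm n σ (aeval (shiftEnd n lam) (conjReverse σ g) u) v := by
  rw [conjReverse_eq_sum]
  conv_lhs => rw [aeval_eq_sum_range]
  simp only [map_sum, LinearMap.sum_apply, map_mul, aeval_C, map_pow, aeval_X,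
    Module.End.mul_apply, Module.algebraMap_end_apply, LinearMap.smul_apply, map_smul,
    LinearMap.map_smulₛₗ, smul_eq_mul]
  refine Finset.sum_congr rfl fun i hi => ?_
  have hi' : i ≤ g.natDegree := Nat.lt_succ_iff.mp (Finset.mem_range.mp hi)
  congr 1
  rw [← sesqForm_shift_pow hlam i ((shiftEnd n lam ^ (g.natDegree - i)) u),
    ← Module.End.mul_apply, ← pow_add, Nat.add_sub_cancel' hi']

theorem word_mem_hermitianDual_iff (hn : 0 < n) {q : ℕ} (hq : ∀ x, σ x = x ^ q) {lam : F}
    (hlam : lam * σ lam = 1) (g a : F[X]) :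
    word n lam a ∈ hermitianDual q (code n lam g) ↔
      (X ^ n - C lam) ∣ conjReverse σ g * a := by
  set T := shiftEnd n lam with hT
  have h1 : word n lam a ∈ hermitianDual q (code n lam g) ↔
      ∀ v, sesqForm n σ (word n lam a) (aeval T g v) = 0 := by
    change (∀ v ∈ code n lam g, ∑ i, word n lam a i * v i ^ q = 0) ↔ _
    simp only [← hq, ← sesqForm_apply]
    constructor
    · intro h v
      obtain ⟨b, rfl⟩ := word_surjective hn lam v
      rw [← word_mul]
      exact h _ ⟨g * b, Ideal.mul_mem_right _ _ (Ideal.mem_span_singleton_self g), rfl⟩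
    · rintro h _ ⟨b, hb, rfl⟩
      obtain ⟨c, rfl⟩ := Ideal.mem_span_singleton.mp hb
      rw [word_mul]
      exact h _
  rw [h1, ← word_eq_zero_iff hn, word_mul, ← hT]
  -- Applying `T ^ g.natDegree` to both arguments preserves the form; commuting it past `g(T)`
  -- yields the shape required by `sesqForm_aeval`.
  have hcomm : ∀ v, (T ^ g.natDegree) (aeval T g v) = aeval T g ((T ^ g.natDegree) v) := by
    intro v
    have : T ^ g.natDegree = aeval T (X ^ g.natDegree : F[X]) := by simp
    rw [this, ← Module.End.mul_apply, ← Module.End.mul_apply, ← map_mul, ← map_mul, mul_comm]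
  constructor
  · intro h
    refine eq_zero_of_sesqForm_eq_zero (σ := σ) fun v => ?_
    obtain ⟨w, rfl⟩ := shift_pow_surjective hlam g.natDegree v
    rw [← sesqForm_aeval hlam, ← hT, ← hcomm, sesqForm_shift_pow hlam]
    exact h w
  · intro h v
    rw [← sesqForm_shift_pow hlam g.natDegree, ← hT, hcomm, sesqForm_aeval hlam, ← hT, h]
    simp

end Hermitian

/-! ### Divisibility between products of coprime prime powers -/

section PrimePowerProducts

variable {R ι : Type*} [CommRing R] [Fintype ι] {f : ι → R}

theorem prod_pow_dvd_iff (hc : Pairwise fun i j => IsCoprime (f i) (f j)) (a : ι → ℕ) (x : R) :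
    ∏ i, f i ^ a i ∣ x ↔ ∀ i, f i ^ a i ∣ x :=
  ⟨fun h i => (Finset.dvd_prod_of_mem _ (Finset.mem_univ i)).trans h,
    Fintype.prod_dvd_of_coprime fun _ _ hij => (hc hij).pow⟩

variable [IsDomain R]

theorem pow_dvd_prod_pow_iff (hf : ∀ i, Irreducible (f i))
    (hc : Pairwise fun i j => IsCoprime (f i) (f j)) (b : ι → ℕ) (i : ι) (m : ℕ) :
    f i ^ m ∣ ∏ j, f j ^ b j ↔ m ≤ b i := by
  classical
  constructor
  · intro h
    rw [← Finset.mul_prod_erase _ _ (Finset.mem_univ i)] at h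
    have hcop : IsCoprime (f i ^ m) (∏ j ∈ Finset.univ.erase i, f j ^ b j) :=
      IsCoprime.prod_right fun j hj => (hc (Finset.ne_of_mem_erase hj).symm).pow
    exact (pow_dvd_pow_iff (hf i).ne_zero (hf i).not_isUnit).mp (hcop.dvd_of_dvd_mul_right h)
  · intro h
    exact (pow_dvd_pow _ h).trans (Finset.dvd_prod_of_mem _ (Finset.mem_univ i))

theorem prod_pow_dvd_prod_pow_iff (hf : ∀ i, Irreducible (f i))
    (hc : Pairwise fun i j => IsCoprime (f i) (f j)) (a b : ι → ℕ) :
    ∏ i, f i ^ a i ∣ ∏ i, f i ^ b i ↔ ∀ i, a i ≤ b i := by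
  rw [prod_pow_dvd_iff hc]
  exact forall_congr' fun i => pow_dvd_prod_pow_iff hf hc b i (a i)

theorem exists_associated_prod_pow [IsPrincipalIdealRing R] (hf : ∀ i, Irreducible (f i)) (P : ℕ) {g : R}
    (hg : g ∣ ∏ i, f i ^ P) :
    ∃ k : ι → Fin (P + 1), Associated g (∏ i, f i ^ (k i : ℕ)) := by
  classical
  suffices h : ∀ (s : Finset ι) (g : R), g ∣ ∏ i ∈ s, f i ^ P →
      ∃ k : ι → Fin (P + 1), Associated g (∏ i ∈ s, f i ^ (k i : ℕ)) from h _ g hg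
  intro s
  induction s using Finset.induction_on with
  | empty =>
    intro g hg
    exact ⟨fun _ => 0, by simpa using associated_one_iff_isUnit.mpr (isUnit_of_dvd_one hg)⟩
  | insert i s his ih =>
    intro g hg
    rw [Finset.prod_insert his] at hg
    obtain ⟨a, b, ha, hb, rfl⟩ := exists_dvd_and_dvd_of_dvd_mul hg
    obtain ⟨k, hk⟩ := ih b hb
    obtain ⟨m, hm, ham⟩ := (dvd_prime_pow (hf i).prime P).mp ha
    refine ⟨Function.update k i ⟨m, Nat.lt_succ_of_le hm⟩, ?_⟩
    rw [Finset.prod_insert his, Function.update_self]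
    refine ham.mul_mul ?_
    rw [Finset.prod_congr rfl fun j hj => ?_]
    · exact hk
    · rw [Function.update_of_ne (fun h : j = i => his (h ▸ hj))]

end PrimePowerProducts

/-! ### Hulls and their average dimension -/

section Hull

variable {F ι : Type*} [Field F] [Fintype ι] {n q P : ℕ} {lam : F} {σ : F →+* F} {f : ι → F[X]}
  {τ : ι → ι}

/-- Cancelling the conjugate reverse of the generator from the modulus leaves the dual's generator,
with exponents `P - k (τ i)`; intersecting codes takes the lcm. -/
theorem hermitianHull_code (hn : 0 < n) (hq : ∀ x, σ x = x ^ q) (hlam : lam * σ lam = 1)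
    (hf : ∀ i, Irreducible (f i)) (hc : Pairwise fun i j => IsCoprime (f i) (f j))
    (hM : ∏ i, f i ^ P = X ^ n - C lam) (hτ : Function.Involutive τ)
    (hfτ : ∀ i, Associated (conjReverse σ (f i)) (f (τ i))) (k : ι → Fin (P + 1)) :
    hermitianHull q (code n lam (∏ i, f i ^ (k i : ℕ))) =
      code n lam (∏ i, f i ^ max (k i : ℕ) (P - k (τ i))) := by
  have hk : ∀ i, (k i : ℕ) ≤ P := fun i => Nat.lt_succ_iff.mp (k i).isLt
  have hdvd : ∀ a : ι → ℕ, (∀ i, a i ≤ P) → ∏ i, f i ^ a i ∣ X ^ n - C lam := fun a ha => by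
    rw [← hM, prod_pow_dvd_prod_pow_iff hf hc]
    exact ha
  have hconj : Associated (conjReverse σ (∏ i, f i ^ (k i : ℕ))) (∏ i, f i ^ (k (τ i) : ℕ)) := by
    rw [← conjReverseHom_apply, map_prod,
      ← Equiv.prod_comp hτ.toPerm fun i => f i ^ (k (τ i) : ℕ)]
    refine Associated.prod _ _ _ fun i _ => ?_
    rw [map_pow, conjReverseHom_apply, Function.Involutive.coe_toPerm, hτ i]
    exact (hfτ i).pow_pow
  have hsplit : X ^ n - C lam = (∏ i, f i ^ (k (τ i) : ℕ)) * ∏ i, f i ^ (P - k (τ i)) := by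
    rw [← hM, ← Finset.prod_mul_distrib]
    refine Finset.prod_congr rfl fun i _ => ?_
    rw [← pow_add, Nat.add_sub_cancel' (hk _)]
  have hne : ∏ i, f i ^ (k (τ i) : ℕ) ≠ 0 :=
    Finset.prod_ne_zero_iff.mpr fun i _ => pow_ne_zero _ (hf i).ne_zero
  ext c
  obtain ⟨a, rfl⟩ := word_surjective hn lam c
  rw [hermitianHull, Submodule.mem_inf, word_mem_code_iff hn lam (hdvd _ hk),
    word_mem_hermitianDual_iff hn hq hlam,
    word_mem_code_iff hn lam (hdvd _ fun i => max_le (hk i) (Nat.sub_le _ _)),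
    (hconj.mul_right a).dvd_iff_dvd_right, hsplit, mul_dvd_mul_iff_left hne,
    prod_pow_dvd_iff hc, prod_pow_dvd_iff hc, prod_pow_dvd_iff hc, ← forall_and]
  refine forall_congr' fun i => ?_
  rcases le_total (k i : ℕ) (P - k (τ i)) with h | h
  · rw [max_eq_right h]
    exact ⟨fun h' => h'.2, fun h' => ⟨(pow_dvd_pow _ h).trans h', h'⟩⟩
  · rw [max_eq_left h]
    exact ⟨fun h' => h'.1, fun h' => ⟨h', (pow_dvd_pow _ h).trans h'⟩⟩

theorem natDegree_prod_pow (hf : ∀ i, Irreducible (f i)) (a : ι → ℕ) :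
    (∏ i, f i ^ a i).natDegree = ∑ i, a i * (f i).natDegree := by
  rw [natDegree_prod _ _ fun i _ => pow_ne_zero _ (hf i).ne_zero]
  simp

theorem finrank_hermitianHull_code (hn : 0 < n) (hq : ∀ x, σ x = x ^ q) (hlam : lam * σ lam = 1)
    (hf : ∀ i, Irreducible (f i)) (hc : Pairwise fun i j => IsCoprime (f i) (f j))
    (hM : ∏ i, f i ^ P = X ^ n - C lam) (hτ : Function.Involutive τ)
    (hfτ : ∀ i, Associated (conjReverse σ (f i)) (f (τ i))) (k : ι → Fin (P + 1)) :
    Module.finrank F (hermitianHull q (code n lam (∏ i, f i ^ (k i : ℕ)))) =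
      ∑ i, (f i).natDegree * min (P - k i) (k (τ i)) := by
  have hk : ∀ i, (k i : ℕ) ≤ P := fun i => Nat.lt_succ_iff.mp (k i).isLt
  have hdvd : ∏ i, f i ^ max (k i : ℕ) (P - k (τ i)) ∣ X ^ n - C lam := by
    rw [← hM, prod_pow_dvd_prod_pow_iff hf hc]
    exact fun i => max_le (hk i) (Nat.sub_le _ _)
  have hnP : n = ∑ i, P * (f i).natDegree := by
    rw [← natDegree_prod_pow hf, hM, natDegree_X_pow_sub_C]
  have h := finrank_code_add_natDegree hn lam hdvd
  rw [natDegree_prod_pow hf] at h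
  rw [hermitianHull_code hn hq hlam hf hc hM hτ hfτ]
  refine Nat.add_right_cancel (h.trans ?_)
  rw [← Finset.sum_add_distrib, hnP]
  refine Finset.sum_congr rfl fun i _ => ?_
  rw [mul_comm, mul_comm (max _ _), ← mul_add]
  have h1 := hk i
  have h2 := hk (τ i)
  congr 1
  omega

theorem averageHullDim_eq_sum [Finite F] [DecidableEq ι] (hn : 0 < n) (hq : ∀ x, σ x = x ^ q)
    (hlam : lam * σ lam = 1)
    (hf : ∀ i, Irreducible (f i)) (hc : Pairwise fun i j => IsCoprime (f i) (f j))
    (hM : ∏ i, f i ^ P = X ^ n - C lam) (hτ : Function.Involutive τ)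
    (hfτ : ∀ i, Associated (conjReverse σ (f i)) (f (τ i))) :
    averageHullDim q n lam = (∑ k : ι → Fin (P + 1), ∑ i,
      ((f i).natDegree : ℚ) * (min (P - k i) (k (τ i)) : ℕ)) / ((P : ℚ) + 1) ^ Fintype.card ι := by
  classical
  have hdvd : ∀ k : ι → Fin (P + 1), ∏ i, f i ^ (k i : ℕ) ∣ X ^ n - C lam := fun k => by
    rw [← hM, prod_pow_dvd_prod_pow_iff hf hc]
    exact fun i => Nat.lt_succ_iff.mp (k i).isLt
  -- Equal codes have generators dividing each other, which forces equal exponents; so summing over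
  -- codes is summing over all `k`.
  have hinj : Function.Injective fun k : ι → Fin (P + 1) =>
      code n lam (∏ i, f i ^ (k i : ℕ)) := by
    intro k l hkl
    have h1 := (code_le_code_iff hn lam (hdvd k) (hdvd l)).mp hkl.le
    have h2 := (code_le_code_iff hn lam (hdvd l) (hdvd k)).mp hkl.ge
    rw [prod_pow_dvd_prod_pow_iff hf hc] at h1 h2
    exact funext fun i => Fin.ext ((h2 i).antisymm (h1 i))
  have himage : constacyclicCodes n lam =
      Finset.univ.image fun k : ι → Fin (P + 1) => code n lam (∏ i, f i ^ (k i : ℕ)) := by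
    ext D
    simp only [constacyclicCodes, Set.Finite.mem_toFinset, Set.mem_ofPred_eq, Finset.mem_image,
      Finset.mem_univ, true_and]
    constructor
    · intro hD
      obtain ⟨g, hg, rfl⟩ := hD.exists_eq_code hn
      obtain ⟨k, hk⟩ := exists_associated_prod_pow hf P (hM ▸ hg)
      exact ⟨k, le_antisymm ((code_le_code_iff hn lam (hdvd k) hg).mpr hk.dvd)
        ((code_le_code_iff hn lam hg (hdvd k)).mpr hk.symm.dvd)⟩
    · rintro ⟨k, rfl⟩
      exact isConstacyclic_code lam _
  have hcard : ((constacyclicCodes n lam).card : ℚ) = ((P : ℚ) + 1) ^ Fintype.card ι := by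
    rw [himage, Finset.card_image_of_injective _ hinj, Finset.card_univ, Fintype.card_fun,
      Fintype.card_fin]
    push_cast
    rfl
  rw [averageHullDim, ← Finset.sum_div, hcard, himage, Finset.sum_image hinj.injOn]
  congr 1
  refine Finset.sum_congr rfl fun k _ => ?_
  rw [finrank_hermitianHull_code hn hq hlam hf hc hM hτ hfτ]
  push_cast
  rfl

theorem averageHullDim_eq [Finite F] [DecidableEq ι] (hn : 0 < n) (hq : ∀ x, σ x = x ^ q)
    (hlam : lam * σ lam = 1)
    (hf : ∀ i, Irreducible (f i)) (hc : Pairwise fun i j => IsCoprime (f i) (f j))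
    (hM : ∏ i, f i ^ P = X ^ n - C lam) (hτ : Function.Involutive τ)
    (hfτ : ∀ i, Associated (conjReverse σ (f i)) (f (τ i))) :
    averageHullDim q n lam = ∑ i, ((f i).natDegree : ℚ) *
      if τ i = i then ((P : ℚ) ^ 2 - if Even P then 0 else 1) / (4 * (P + 1))
      else (P : ℚ) * (2 * P + 1) / (6 * (P + 1)) := by
  have hP : (P : ℚ) + 1 ≠ 0 := by positivity
  rw [averageHullDim_eq_sum hn hq hlam hf hc hM hτ hfτ, Finset.sum_comm, Finset.sum_div]
  refine Finset.sum_congr rfl fun i _ => ?_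
  rw [← Finset.mul_sum, mul_div_assoc]
  congr 1
  rw [div_eq_iff (pow_ne_zero _ hP)]
  by_cases hi : τ i = i
  · rw [if_pos hi]
    have h := card_mul_sum_apply (A := Fin (P + 1)) i
      fun a => ((min (P - a) a : ℕ) : ℚ)
    have h4 := congrArg (Nat.cast (R := ℚ)) (four_mul_sum_min_sub_self P)
    rw [Finset.sum_range] at h4
    rw [hi]
    rw [Fintype.card_fin] at h
    push_cast at h h4 ⊢
    generalize ∑ k : ι → Fin (P + 1), min ((P - k i : ℕ) : ℚ) (k i : ℕ) = S at *
    rw [← h4]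
    field_simp
    linear_combination 4 * h
  · rw [if_neg hi]
    have h := card_sq_mul_sum_apply_apply (A := Fin (P + 1)) hi
      fun a b => ((min (P - a) b : ℕ) : ℚ)
    have h6 := congrArg (Nat.cast (R := ℚ)) (six_mul_sum_sum_min_sub P)
    simp only [Finset.sum_range] at h6
    rw [Fintype.card_fin] at h
    push_cast at h h6 ⊢
    generalize ∑ k : ι → Fin (P + 1), min ((P - k i : ℕ) : ℚ) (k (τ i) : ℕ) = S at *
    refine mul_left_cancel₀ (pow_ne_zero 2 hP) (h.trans ?_)
    field_simp
    linear_combination h6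

end Hull

open UniqueFactorizationMonoid

/-! ### The involution on irreducible factors -/

section Factors

variable {F : Type*} [Field F] {m q : ℕ} {a : F} {σ : F →+* F} {f : F[X]}

theorem coeff_zero_ne_zero_of_dvd (hm : 0 < m) (ha : a ≠ 0) (hf : f ∣ X ^ m - C a) :
    f.coeff 0 ≠ 0 := by
  obtain ⟨g, hg⟩ := hf
  have h := congrArg (fun p => coeff p 0) hg
  simp only [coeff_sub, coeff_X_pow, coeff_C_zero, mul_coeff_zero, if_neg hm.ne] at h
  intro h0
  rw [h0, zero_mul, zero_sub, neg_eq_zero] at h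
  exact ha h

theorem associated_conjReverse_conjReciprocal (hq : ∀ x, σ x = x ^ q) (hf : f.coeff 0 ≠ 0) :
    Associated (conjReverse σ f) (conjReciprocal q f) := by
  rw [conjReciprocal_eq hq]
  refine (associated_unit_mul_left _ _ (isUnit_C.mpr ?_)).symm
  exact (inv_ne_zero (by simpa using hf)).isUnit

theorem monic_conjReciprocal (hq : ∀ x, σ x = x ^ q) (hf : f.coeff 0 ≠ 0) :
    (conjReciprocal q f).Monic := by
  have : σ (f.coeff 0) ≠ 0 := by simpa using hf
  rw [conjReciprocal_eq hq, Monic, leadingCoeff_mul, leadingCoeff_C,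
    leadingCoeff_conjReverse σ hf, inv_mul_cancel₀ this]

theorem conjReciprocal_dvd (hq : ∀ x, σ x = x ^ q) (hm : 0 < m) (ha : a * σ a = 1)
    (hf : f ∣ X ^ m - C a) : conjReciprocal q f ∣ X ^ m - C a := by
  have h0 := coeff_zero_ne_zero_of_dvd hm (left_ne_zero_of_mul_eq_one ha) hf
  rw [← (associated_conjReverse_conjReciprocal hq h0).dvd_iff_dvd_left,
    ← (conjReverse_X_pow_sub_C σ m ha).dvd_iff_dvd_right]
  have h := map_dvd (conjReverseHom σ) hf
  rwa [conjReverseHom_apply, conjReverseHom_apply] at h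

theorem conjReciprocal_conjReciprocal (hq : ∀ x, σ x = x ^ q) (hσ : ∀ x, σ (σ x) = x)
    (hf : f.coeff 0 ≠ 0) (hm : f.Monic) :
    conjReciprocal q (conjReciprocal q f) = f := by
  have h1 := associated_conjReverse_conjReciprocal hq hf
  have h0 : (conjReciprocal q f).coeff 0 ≠ 0 := by
    rw [conjReciprocal_eq hq, coeff_C_mul]
    exact mul_ne_zero (inv_ne_zero (by simpa using hf))
      (conjReverse_coeff_zero_ne_zero σ hm.ne_zero)
  refine eq_of_monic_of_associated (monic_conjReciprocal hq h0) hm ?_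
  refine (associated_conjReverse_conjReciprocal hq h0).symm.trans ?_
  have h := h1.symm.map (conjReverseHom σ)
  rwa [conjReverseHom_apply, conjReverseHom_apply, conjReverse_conjReverse hσ hf] at h

theorem isCoprime_of_monic_irreducible {f g : F[X]} (hf : Irreducible f) (hg : Irreducible g)
    (hfm : f.Monic) (hgm : g.Monic) (h : f ≠ g) : IsCoprime f g :=
  (hf.coprime_iff_not_dvd).mpr fun hd =>
    h (eq_of_monic_of_associated hfm hgm (hf.associated_of_dvd hg hd))

theorem averageHullDim_eq_of_separable [Finite F] (hq : ∀ x, σ x = x ^ q)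
    (hσ : ∀ x, σ (σ x) = x) (hm : 0 < m) (ha : a * σ a = 1)
    (hsep : (X ^ m - C a).Separable) {P n : ℕ} {lam : F} (hn : 0 < n) (hlam : lam * σ lam = 1)
    (hP : (X ^ m - C a) ^ P = X ^ n - C lam) :
    averageHullDim q n lam =
      (m : ℚ) * (P * (2 * P + 1) / (6 * (P + 1))) - (selfConjDegree q m a : ℚ) *
        (P * (2 * P + 1) / (6 * (P + 1)) -
          ((P : ℚ) ^ 2 - if Even P then 0 else 1) / (4 * (P + 1))) := by
  classical
  have ha0 : a ≠ 0 := left_ne_zero_of_mul_eq_one ha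
  have hM := monic_modulus hm a
  have hM0 := hM.ne_zero
  set N := normalizedFactors (X ^ m - C a) with hN
  have hmem : ∀ {g}, g ∈ N ↔ Irreducible g ∧ g.Monic ∧ g ∣ X ^ m - C a :=
    Polynomial.mem_normalizedFactors_iff hM0
  have hnodup : N.Nodup := (squarefree_iff_nodup_normalizedFactors hM0).mp hsep.squarefree
  have hprod : N.prod = X ^ m - C a := by
    rw [hN, prod_normalizedFactors_eq hM0, hM.normalize_eq_self]
  -- Separability makes the factors distinct, so they can serve as their own index set.
  let S : Finset F[X] := ⟨N, hnodup⟩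
  have hS : ∀ i : S, Irreducible (i : F[X]) ∧ (i : F[X]).Monic ∧ (i : F[X]) ∣ X ^ m - C a :=
    fun i => hmem.mp i.2
  have h0 : ∀ i : S, (i : F[X]).coeff 0 ≠ 0 := fun i =>
    coeff_zero_ne_zero_of_dvd hm ha0 (hS i).2.2
  have hτS : ∀ i : S, conjReciprocal q i ∈ S := fun i => hmem.mpr
    ⟨(associated_conjReverse_conjReciprocal hq (h0 i)).irreducible
      (irreducible_conjReverse hσ (h0 i) (hS i).1),
      monic_conjReciprocal hq (h0 i), conjReciprocal_dvd hq hm ha (hS i).2.2⟩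
  let τ : S → S := fun i => ⟨conjReciprocal q i, hτS i⟩
  have hprodS : ∏ i : S, (i : F[X]) = X ^ m - C a := by
    rw [Finset.prod_coe_sort S fun i => i, ← hprod]
    simp [S, Finset.prod]
  have hdeg : ∑ i : S, ((i : F[X]).natDegree : ℚ) = m := by
    rw [← Nat.cast_sum, ← natDegree_prod _ _ fun i _ => (hS i).1.ne_zero, hprodS,
      natDegree_X_pow_sub_C]
  have hfix : ∀ i : S, τ i = i ↔ IsSelfConjReciprocal q (i : F[X]) := fun i => by
    rw [Subtype.ext_iff]
    exact ⟨fun h => ⟨h0 i, h⟩, fun h => h.2⟩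
  have hB : (selfConjDegree q m a : ℚ) =
      ∑ i : S, if τ i = i then ((i : F[X]).natDegree : ℚ) else 0 := by
    simp only [hfix]
    rw [Finset.sum_coe_sort S fun i => if IsSelfConjReciprocal q i then (i.natDegree : ℚ) else 0,
      ← Finset.sum_filter, ← Nat.cast_sum]
    rfl
  rw [averageHullDim_eq (f := fun i : S => (i : F[X])) (P := P) (τ := τ) hn hq hlam
    (fun i => (hS i).1)
    (fun i j hij => isCoprime_of_monic_irreducible (hS i).1 (hS j).1 (hS i).2.1 (hS j).2.1
      fun h => hij (Subtype.ext h))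
    (by rw [Finset.prod_pow, hprodS, hP])
    (fun i => Subtype.ext (conjReciprocal_conjReciprocal hq hσ (h0 i) (hS i).2.1))
    (fun i => associated_conjReverse_conjReciprocal hq (h0 i)),
    hB, ← hdeg, Finset.sum_mul, Finset.sum_mul, ← Finset.sum_sub_distrib]
  refine Finset.sum_congr rfl fun i _ => ?_
  by_cases hi : τ i = i
  · rw [if_pos hi, if_pos hi]
    ring
  · rw [if_neg hi, if_neg hi]
    ring

end Factors

end ConstacyclicHull

theorem theorem1 {F : Type*} [Field F] [Fintype F] (p q : ℕ) [CharP F p]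
    (hF : Fintype.card F = q ^ 2)
    (n nbar ν : ℕ) (hn : 0 < n) (hnbar : n = nbar * p ^ ν) (hp : ¬ p ∣ nbar)
    (lam : F) (r : ℕ) (hr : orderOf lam = r) (hrq : r ∣ q + 1)
    (Lam : F) (hLam : Lam ^ p ^ ν = lam) :
    ConstacyclicHull.averageHullDim q n lam =
      (n : ℚ) * (1 / 3 - 1 / (6 * ((p : ℚ) ^ ν + 1))) -
        (ConstacyclicHull.selfConjDegree q nbar Lam : ℚ) *
          (((p : ℚ) ^ ν + 1) / 12 +
            (2 - 3 * (if Even (p ^ ν) then 1 else 0)) / (12 * ((p : ℚ) ^ ν + 1))) := by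
  have hpp : p.Prime := CharP.char_is_prime F p
  have : Fact p.Prime := ⟨hpp⟩
  obtain ⟨k, -, hk⟩ := FiniteField.card F p
  obtain ⟨s, -, rfl⟩ : ∃ s ≤ (k : ℕ), q = p ^ s := by
    rw [← Nat.dvd_prime_pow hpp, ← hk, hF]
    exact dvd_pow_self q two_ne_zero
  have hq : ∀ x : F, iterateFrobenius F p s x = x ^ p ^ s := fun x => iterateFrobenius_def p s x
  have hσ : ∀ x : F, iterateFrobenius F p s (iterateFrobenius F p s x) = x := fun x => by
    rw [hq, hq, ← pow_mul, ← sq, ← hF, FiniteField.pow_card]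
  have hlam : lam * iterateFrobenius F p s lam = 1 := by
    rw [hq, ← pow_succ']
    exact orderOf_dvd_iff_pow_eq_one.mp (hr ▸ hrq)
  -- The `p ^ ν`-th power of the left side is `lam * lam ^ q = 1`, and Frobenius is injective.
  have hLam1 : Lam * iterateFrobenius F p s Lam = 1 := by
    apply iterateFrobenius_inj F p ν
    rw [map_one, map_mul, iterateFrobenius_def, hLam, iterateFrobenius_def, hq, ← pow_mul,
      mul_comm (p ^ s), pow_mul, hLam, ← hq, hlam]
  have hm : 0 < nbar := Nat.pos_of_ne_zero fun h => by simp [h] at hp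
  have hpow : (Polynomial.X ^ nbar - Polynomial.C Lam) ^ p ^ ν =
      Polynomial.X ^ n - Polynomial.C lam := by
    rw [sub_pow_char_pow, ← pow_mul, ← hnbar, ← Polynomial.C_pow, hLam]
  rw [ConstacyclicHull.averageHullDim_eq_of_separable hq hσ hm hLam1
    (Polynomial.separable_X_pow_sub_C' p nbar Lam hp (left_ne_zero_of_mul_eq_one hLam1)) hn hlam
    hpow, hnbar]
  have hP : ((p : ℚ) ^ ν) + 1 ≠ 0 := by positivity
  push_cast
  split_ifs <;> field_simp <;> ring
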